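/- Let $X_1, X_2, \ldots$ be i.i.d. real random variables with the symmetric Laplace density $\frac12 e^{-|x|}$, and let $S_0 = 0$, $S_k = X_1 + \cdots + X_k$. Let $\tau^- = \inf\{k : S_k < 0\}$ and $\nu = \tau^- - 1$, and let $M_0 \le M_1 \le \cdots \le M_\nu$ be the order statistics of $\{S_0, S_1, \ldots, S_\nu\}$, with spacings $\Delta_k = M_k - M_{k-1}$ for $1 \le k \le \nu$. Then $\nu < \infty$ almost surely and, for every $n \ge 1$, $\mathbb{P}(\nu = n) > 0$ and, conditionally on $\{\nu = n\}$, the spacings are reversible in law: $$(\Delta_1, \ldots, \Delta_n \mid \nu = n) \stackrel{d}{=} (\Delta_n, \ldots, \Delta_1 \mid \nu = n).$$ Moreover, for all $1 \le m \le n$, $$(\Delta_1, \ldots, \Delta_m \mid \nu \ge n) \stackrel{d}{=} (\Delta_\nu, \Delta_{\nu-1}, \ldots, \Delta_{\nu-m+1} \mid \nu \ge n).$$ -/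

import Mathlib

open MeasureTheory ProbabilityTheory

namespace LaplaceWalk

/-- The symmetric Laplace distribution on the line, with density `(1/2) * exp (-|x|)`. -/
noncomputable def laplaceMeasure : Measure ℝ :=
  volume.withDensity fun x => ENNReal.ofReal (1 / 2 * Real.exp (-|x|))

/-- The walk with increments `X 0, X 1, …`: `S 0 = 0` and `S k = X 0 + ⋯ + X (k - 1)`. -/
def walk {Ω : Type*} (X : ℕ → Ω → ℝ) (k : ℕ) (ω : Ω) : ℝ :=
  ∑ i ∈ Finset.range k, X i ω

/-- The first descending ladder time `inf {k : S k < 0}`, equal to `⊤` if there is no such `k`. -/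
noncomputable def tauMinus {Ω : Type*} (X : ℕ → Ω → ℝ) (ω : Ω) : ℕ∞ :=
  hittingAfter (walk X) (Set.Iio 0) 0 ω

/-- `ν = τ⁻ - 1`. As `S 0 = 0`, one has `τ⁻ ≥ 1`, so that the subtraction does not truncate;
also `⊤ - 1 = ⊤`. -/
noncomputable def nu {Ω : Type*} (X : ℕ → Ω → ℝ) (ω : Ω) : ℕ∞ :=
  tauMinus X ω - 1

/-- The `k`-th order statistic (`0 ≤ k ≤ n`) of the values `x 0, …, x n`, i.e. the entry with
index `k` of the nondecreasing rearrangement of these values; `0` if `k > n`. -/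
noncomputable def orderStat (n : ℕ) (x : ℕ → ℝ) (k : ℕ) : ℝ :=
  if h : k < n + 1 then x (Tuple.sort (fun i : Fin (n + 1) => x i) ⟨k, h⟩) else 0

/-- `M k`, the `k`-th order statistic of `S 0, …, S ν`. It is meaningful for `k ≤ ν < ⊤`. -/
noncomputable def M {Ω : Type*} (X : ℕ → Ω → ℝ) (k : ℕ) (ω : Ω) : ℝ :=
  orderStat (nu X ω).toNat (fun i => walk X i ω) k

/-- The spacing `Δ k = M k - M (k - 1)`. It is meaningful for `1 ≤ k ≤ ν < ⊤`. -/
noncomputable def spacing {Ω : Type*} (X : ℕ → Ω → ℝ) (k : ℕ) (ω : Ω) : ℝ :=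
  M X k ω - M X (k - 1) ω

end LaplaceWalk

open MeasureTheory ProbabilityTheory
open scoped ENNReal

namespace LaplaceWalk

/-! ### Order statistics -/

/-! On `{ν = n}` the walk is nonnegative up to time `n` and the next step falls below `0`. From
height `s ≥ 0` this has probability `exp (-s) / 2`, which is the Laplace density at `s`
(`laplaceMeasure_Iio_neg`). So the first `n` increments carry the weight of a bridge closed up by a
step `-S n`, restricted to nonnegative bridges (`measure_nu_eq_inter_eq_bridgeMeasure`). The
unrestricted bridge measure is invariant under cyclic rotation and under negation. Spacings do not
change under rotation, and negation reverses their order. Negation does not preserve nonnegativity,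
but almost every bridge has exactly one nonnegative rotation. By `cycle_lemma` the restriction
therefore only costs a factor `n + 1` on rotation-invariant events, and reversibility follows
(`bridgeMeasure_spacing_reverse`). For `{ν ≥ n}`, sum over the finite values of `ν`. That `ν` is
almost surely finite comes from the harmonic function `z + 1` of the killed walk
(`measure_nu_eq_top`). -/

theorem orderStat_of_le {n k : ℕ} (hk : k ≤ n) (x : ℕ → ℝ) :
    orderStat n x k = ((fun i : Fin (n + 1) => x i) ∘ Tuple.sort (fun i : Fin (n + 1) => x i))
      ⟨k, Nat.lt_succ_of_le hk⟩ := by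
  simp [orderStat, Nat.lt_succ_of_le hk]

theorem orderStat_congr {n : ℕ} {x y : ℕ → ℝ} (h : ∀ i ≤ n, x i = y i) (k : ℕ) :
    orderStat n x k = orderStat n y k := by
  have : (fun i : Fin (n + 1) => x i) = fun i : Fin (n + 1) => y i :=
    funext fun i => h i (Nat.le_of_lt_succ i.2)
  by_cases hk : k ≤ n
  · rw [orderStat_of_le hk, orderStat_of_le hk, this]
  · simp [orderStat, show ¬ k < n + 1 by omega]

/-- Ties make the sorting permutation ambiguous but not the sorted values, so any convenient sorting
permutation may be used. -/
theorem orderStat_eq_of_perm {n k : ℕ} (hk : k ≤ n) (x : ℕ → ℝ) (σ : Equiv.Perm (Fin (n + 1)))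
    (hσ : Monotone fun i : Fin (n + 1) => x (σ i)) :
    orderStat n x k = x (σ ⟨k, Nat.lt_succ_of_le hk⟩) := by
  rw [orderStat_of_le hk]
  have := (Tuple.comp_sort_eq_comp_iff_monotone
    (f := fun i : Fin (n + 1) => x i) (σ := σ)).2 hσ
  exact (congrFun this _).symm

theorem monotone_sort_orderStat (n : ℕ) (x : ℕ → ℝ) :
    Monotone fun i : Fin (n + 1) => x (Tuple.sort (fun i : Fin (n + 1) => x i) i) :=
  Tuple.monotone_sort (fun i : Fin (n + 1) => x i)

theorem orderStat_sub_const {n k : ℕ} (hk : k ≤ n) (x : ℕ → ℝ) (c : ℝ) :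
    orderStat n (fun i => x i - c) k = orderStat n x k - c := by
  rw [orderStat_eq_of_perm hk _ (Tuple.sort (fun i : Fin (n + 1) => x i)),
    orderStat_eq_of_perm hk x _ (monotone_sort_orderStat n x)]
  exact fun i j hij => sub_le_sub_right (monotone_sort_orderStat n x hij) c

theorem orderStat_neg {n k : ℕ} (hk : k ≤ n) (x : ℕ → ℝ) :
    orderStat n (fun i => -x i) k = -orderStat n x (n - k) := by
  rw [orderStat_eq_of_perm hk _ (Fin.revPerm.trans (Tuple.sort (fun i : Fin (n + 1) => x i))),
    orderStat_eq_of_perm (Nat.sub_le n k) x _ (monotone_sort_orderStat n x)]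
  · congr 3
    simp [Fin.ext_iff, Fin.val_rev]
  · intro i j hij
    exact neg_le_neg (monotone_sort_orderStat n x (Fin.rev_le_rev.2 hij))

theorem orderStat_shift {n k : ℕ} (hk : k ≤ n) (x : ℕ → ℝ) (hx : Function.Periodic x (n + 1))
    (m : ℕ) : orderStat n (fun i => x (i + m)) k = orderStat n x k := by
  have h : (fun i : Fin (n + 1) => x (i + m)) =
      (fun i : Fin (n + 1) => x i) ∘ Equiv.addRight (Fin.ofNat (n + 1) m) := by
    funext i
    simp only [Function.comp, Equiv.coe_addRight, Fin.val_add, Fin.val_ofNat, Nat.add_mod_mod]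
    rw [hx.map_mod_nat]
  rw [orderStat_of_le hk, orderStat_of_le hk, h, Tuple.comp_perm_comp_sort_eq_comp_sort]

theorem measurable_orderStat (n k : ℕ) : Measurable fun x : ℕ → ℝ => orderStat n x k := by
  by_cases hk : k ≤ n
  swap
  · simp [orderStat, show ¬ k < n + 1 by omega]
  intro s hs
  -- The sorting permutation depends on `x`, so split over the finitely many candidates; the pieces
  -- may overlap at ties.
  have : (fun x : ℕ → ℝ => orderStat n x k) ⁻¹' s = ⋃ σ : Equiv.Perm (Fin (n + 1)),
      {x | ∀ i j : Fin (n + 1), i ≤ j → x (σ i) ≤ x (σ j)} ∩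
        {x | x (σ ⟨k, Nat.lt_succ_of_le hk⟩) ∈ s} := by
    ext x
    simp only [Set.mem_preimage, Set.mem_iUnion, Set.mem_inter_iff, Set.mem_ofPred_eq]
    constructor
    · intro h
      refine ⟨_, fun i j hij => monotone_sort_orderStat n x hij, ?_⟩
      rwa [← orderStat_eq_of_perm hk x _ (monotone_sort_orderStat n x)]
    · rintro ⟨σ, hσ, h⟩
      rwa [orderStat_eq_of_perm hk x σ fun i j hij => hσ i j hij]
  rw [this]
  refine MeasurableSet.iUnion fun σ => MeasurableSet.inter ?_ ?_
  · simp only [Set.ofPred_forall]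
    refine MeasurableSet.iInter fun i => MeasurableSet.iInter fun j => MeasurableSet.iInter fun _ =>
      measurableSet_le (measurable_pi_apply _) (measurable_pi_apply _)
  · exact measurable_pi_apply _ hs

/-! ### Closed bridges -/

section Bridge

variable {n : ℕ}

/-- The closing up of the increments `x 0, …, x (n - 1)` to a sequence of period `n + 1` with sum
`0` over each period. -/
noncomputable def closing (x : Fin n → ℝ) (i : ℕ) : ℝ :=
  if h : i % (n + 1) < n then x ⟨i % (n + 1), h⟩ else -∑ j, x j

/-- The closed walk with increments `closing x`. -/
noncomputable def bridge (x : Fin n → ℝ) (k : ℕ) : ℝ := ∑ i ∈ Finset.range k, closing x i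

theorem closing_periodic (x : Fin n → ℝ) : Function.Periodic (closing x) (n + 1) := by
  intro i
  simp [closing]

theorem closing_of_lt (x : Fin n → ℝ) {i : ℕ} (hi : i < n) : closing x i = x ⟨i, hi⟩ := by
  have : i % (n + 1) = i := Nat.mod_eq_of_lt (by omega)
  simp [closing, this, hi]

theorem bridge_self (x : Fin n → ℝ) : bridge x n = ∑ i, x i := by
  rw [bridge, Finset.sum_range]
  exact Finset.sum_congr rfl fun i _ => closing_of_lt x i.2

theorem closing_self (x : Fin n → ℝ) : closing x n = -bridge x n := by
  simp [closing, bridge_self]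

theorem bridge_zero (x : Fin n → ℝ) : bridge x 0 = 0 := by simp [bridge]

theorem bridge_succ (x : Fin n → ℝ) (k : ℕ) : bridge x (k + 1) = bridge x k + closing x k := by
  simp [bridge, Finset.sum_range_succ]

theorem bridge_periodic (x : Fin n → ℝ) : Function.Periodic (bridge x) (n + 1) := by
  intro k
  induction k with
  | zero => rw [zero_add, bridge_succ, closing_self, bridge_zero]; ring
  | succ k ih =>
    rw [show k + 1 + (n + 1) = (k + (n + 1)) + 1 by ring, bridge_succ, bridge_succ, ih,
      closing_periodic]

theorem closing_add (x y : Fin n → ℝ) (i : ℕ) :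
    closing (x + y) i = closing x i + closing y i := by
  unfold closing
  split_ifs
  · rfl
  · simp [Finset.sum_add_distrib]; ring

theorem closing_smul (c : ℝ) (x : Fin n → ℝ) (i : ℕ) : closing (c • x) i = c * closing x i := by
  unfold closing
  split_ifs
  · rfl
  · simp [Finset.mul_sum]

theorem closing_neg (x : Fin n → ℝ) (i : ℕ) : closing (-x) i = -closing x i := by
  have := closing_smul (-1) x i
  simpa using this

theorem bridge_neg (x : Fin n → ℝ) (k : ℕ) : bridge (-x) k = -bridge x k := by
  simp [bridge, closing_neg]

@[fun_prop]
theorem measurable_closing (i : ℕ) : Measurable fun x : Fin n → ℝ => closing x i := by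
  unfold closing
  split_ifs <;> fun_prop

@[fun_prop]
theorem measurable_bridge (k : ℕ) : Measurable fun x : Fin n → ℝ => bridge x k := by
  unfold bridge
  fun_prop

/-- The cyclic shift of the increments of a bridge. -/
noncomputable def rotate (n : ℕ) : (Fin n → ℝ) →ₗ[ℝ] (Fin n → ℝ) where
  toFun x i := closing x (i + 1)
  map_add' x y := funext fun _ => closing_add x y _
  map_smul' c x := funext fun _ => closing_smul c x _

theorem closing_rotate (x : Fin n → ℝ) (i : ℕ) :
    closing (rotate n x) i = closing x (i + 1) := by
  have hper (j : ℕ) : closing x (j % (n + 1) + 1) = closing x (j + 1) := by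
    rw [← (closing_periodic x).map_mod_nat (j % (n + 1) + 1), Nat.mod_add_mod,
      (closing_periodic x).map_mod_nat]
  rw [← hper, closing]
  split_ifs with h
  · rfl
  -- The last increment is not stored but is minus the sum of the others; the zero sum over a period
  -- identifies it with `closing x 0`.
  · have hn : i % (n + 1) = n := by
      have : i % (n + 1) < n + 1 := Nat.mod_lt i (Nat.succ_pos n)
      omega
    have h0 := bridge_periodic x 0
    rw [zero_add, bridge_zero, bridge, Finset.sum_range_succ', Finset.sum_range] at h0
    rw [hn, ← zero_add (n + 1), closing_periodic]
    change -∑ j : Fin n, closing x (j + 1) = _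
    linarith

theorem closing_rotate_pow (x : Fin n → ℝ) (m i : ℕ) :
    closing ((rotate n ^ m) x) i = closing x (i + m) := by
  induction m generalizing i with
  | zero => simp
  | succ m ih =>
    rw [pow_succ', Module.End.mul_apply, closing_rotate, ih]
    congr 1
    ring

theorem bridge_rotate_pow (x : Fin n → ℝ) (m k : ℕ) :
    bridge ((rotate n ^ m) x) k = bridge x (k + m) - bridge x m := by
  induction k with
  | zero => simp [bridge_zero]
  | succ k ih =>
    rw [bridge_succ, ih, closing_rotate_pow, show k + 1 + m = (k + m) + 1 by ring, bridge_succ]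
    ring

theorem rotate_pow_succ : rotate n ^ (n + 1) = 1 := by
  refine LinearMap.ext fun x => funext fun i => ?_
  have h := closing_of_lt ((rotate n ^ (n + 1)) x) i.2
  rw [closing_rotate_pow, closing_periodic, closing_of_lt _ i.2] at h
  exact h.symm

/-- A linear map of finite order has determinant of modulus one; this gives invariance of Lebesgue
measure without computing a matrix. -/
theorem abs_det_rotate : |LinearMap.det (rotate n)| = 1 := by
  have h : |LinearMap.det (rotate n)| ^ (n + 1) = 1 := by
    rw [← abs_pow, ← map_pow, rotate_pow_succ, map_one, abs_one]
  exact (pow_eq_one_iff_of_nonneg (abs_nonneg _) (Nat.succ_ne_zero n)).1 h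

@[fun_prop]
theorem measurable_rotate : Measurable (rotate n) :=
  (rotate n).continuous_of_finiteDimensional.measurable

theorem measurePreserving_rotate_volume : MeasurePreserving (rotate n) volume volume := by
  refine ⟨measurable_rotate, ?_⟩
  have h : LinearMap.det (rotate n) ≠ 0 := by
    intro h
    have := abs_det_rotate (n := n)
    simp [h] at this
  rw [Real.map_linearMap_volume_pi_eq_smul_volume_pi h, abs_inv, abs_det_rotate]
  simp

/-! ### The bridge measure -/

/-- The density of the Laplace distribution. -/
noncomputable def laplaceDensity (y : ℝ) : ℝ≥0∞ := ENNReal.ofReal (1 / 2 * Real.exp (-|y|))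

@[fun_prop]
theorem measurable_laplaceDensity : Measurable laplaceDensity := by
  unfold laplaceDensity
  fun_prop

theorem laplaceDensity_neg (y : ℝ) : laplaceDensity (-y) = laplaceDensity y := by
  simp [laplaceDensity]

theorem laplaceDensity_ne_zero (y : ℝ) : laplaceDensity y ≠ 0 := by
  have := Real.exp_pos (-|y|)
  simp [laplaceDensity, this]

/-- The product of the Laplace densities of the increments of a closed bridge. -/
noncomputable def bridgeDensity (x : Fin n → ℝ) : ℝ≥0∞ :=
  ∏ i ∈ Finset.range (n + 1), laplaceDensity (closing x i)

@[fun_prop]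
theorem measurable_bridgeDensity : Measurable (bridgeDensity (n := n)) := by
  unfold bridgeDensity
  fun_prop

theorem bridgeDensity_rotate (x : Fin n → ℝ) : bridgeDensity (rotate n x) = bridgeDensity x := by
  simp only [bridgeDensity, closing_rotate]
  rw [Finset.prod_range_succ, Finset.prod_range_succ', ← zero_add (n + 1), closing_periodic]

theorem bridgeDensity_neg (x : Fin n → ℝ) : bridgeDensity (-x) = bridgeDensity x := by
  simp [bridgeDensity, closing_neg, laplaceDensity_neg]

theorem bridgeDensity_eq (x : Fin n → ℝ) :
    bridgeDensity x = (∏ i, laplaceDensity (x i)) * laplaceDensity (bridge x n) := by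
  rw [bridgeDensity, Finset.prod_range_succ, closing_self, laplaceDensity_neg, Finset.prod_range]
  congr 1
  exact Finset.prod_congr rfl fun i _ => by rw [closing_of_lt x i.2]

/-- The law of the increments of closed Laplace bridges (not normalized). -/
noncomputable def bridgeMeasure (n : ℕ) : Measure (Fin n → ℝ) :=
  volume.withDensity bridgeDensity

theorem measurePreserving_withDensity_of_comp_eq {α : Type*} [MeasurableSpace α] {μ : Measure α}
    {T : α → α} (hT : MeasurePreserving T μ μ) {f : α → ℝ≥0∞} (hf : Measurable f)
    (h : ∀ x, f (T x) = f x) : MeasurePreserving T (μ.withDensity f) (μ.withDensity f) := by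
  refine ⟨hT.measurable, Measure.ext fun s hs => ?_⟩
  rw [Measure.map_apply hT.measurable hs, withDensity_apply _ hs,
    withDensity_apply _ (hT.measurable hs), ← hT.setLIntegral_comp_preimage hs hf]
  simp [h]

theorem measurePreserving_rotate :
    MeasurePreserving (rotate n) (bridgeMeasure n) (bridgeMeasure n) :=
  measurePreserving_withDensity_of_comp_eq measurePreserving_rotate_volume
    measurable_bridgeDensity bridgeDensity_rotate

theorem measurePreserving_neg_bridgeMeasure :
    MeasurePreserving (fun x => -x) (bridgeMeasure n) (bridgeMeasure n) :=
  measurePreserving_withDensity_of_comp_eq (Measure.measurePreserving_neg volume)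
    measurable_bridgeDensity bridgeDensity_neg

/-- Such ties fill a proper linear subspace. The unit increment at position `m` lies outside it: its
bridge is `0` at time `m` and `1` at time `l`. -/
theorem bridgeMeasure_bridge_eq {m l : ℕ} (hml : m < l) (hl : l ≤ n) :
    bridgeMeasure n {x | bridge x m = bridge x l} = 0 := by
  refine withDensity_absolutelyContinuous _ _ ?_
  let E : Submodule ℝ (Fin n → ℝ) :=
    { carrier := {x | bridge x m = bridge x l}
      add_mem' := by
        intro a b ha hb
        simp only [Set.mem_ofPred_eq, bridge, closing_add, Finset.sum_add_distrib] at *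
        rw [ha, hb]
      zero_mem' := by
        have (k : ℕ) : closing (0 : Fin n → ℝ) k = 0 := by simp [closing]
        simp [bridge, this]
      smul_mem' := by
        intro c a ha
        simp only [Set.mem_ofPred_eq, bridge, closing_smul, ← Finset.mul_sum] at *
        rw [ha] }
  refine Measure.addHaar_submodule volume E fun h => ?_
  have hm : m < n := hml.trans_le hl
  have h1 : (Pi.single ⟨m, hm⟩ 1 : Fin n → ℝ) ∈ E := h ▸ Submodule.mem_top
  change bridge _ m = bridge _ l at h1
  have hb (k : ℕ) (hk : k ≤ n) : bridge (Pi.single ⟨m, hm⟩ 1 : Fin n → ℝ) k =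
      if m < k then 1 else 0 := by
    refine Eq.trans ?_ ((Finset.sum_ite_eq' (Finset.range k) m fun _ => (1 : ℝ)).trans (by simp))
    refine Finset.sum_congr rfl fun i hi => ?_
    rw [closing_of_lt _ ((Finset.mem_range.1 hi).trans_le hk), Pi.single_apply]
    simp [Fin.ext_iff]
  rw [hb m hm.le, hb l hl] at h1
  simp [hml] at h1

/-- The bridges that stay nonnegative, i.e. whose minimum over a period is attained at `0`. -/
def nonnegBridges (n : ℕ) : Set (Fin n → ℝ) := {x | ∀ j ≤ n, 0 ≤ bridge x j}

theorem measurableSet_nonnegBridges : MeasurableSet (nonnegBridges n) := by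
  simp only [nonnegBridges, Set.ofPred_forall]
  exact MeasurableSet.iInter fun j => MeasurableSet.iInter fun _ =>
    measurableSet_le measurable_const (measurable_bridge j)

theorem rotate_pow_mem_nonnegBridges {m : ℕ} {x : Fin n → ℝ} :
    (rotate n ^ m) x ∈ nonnegBridges n ↔ ∀ j, bridge x m ≤ bridge x j := by
  simp only [nonnegBridges, Set.mem_ofPred_eq, bridge_rotate_pow, sub_nonneg]
  refine ⟨fun h j => ?_, fun h j _ => h _⟩
  have h1 : ∀ j, bridge x m ≤ bridge x (j + m) := fun j => by
    have h2 := h (j % (n + 1)) (Nat.le_of_lt_succ (Nat.mod_lt _ (Nat.succ_pos n)))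
    rwa [← (bridge_periodic x).map_mod_nat (j % (n + 1) + m), Nat.mod_add_mod,
      (bridge_periodic x).map_mod_nat] at h2
  -- Adding `m` to `j + m * n` gives `j + m * (n + 1)`, which is `j` modulo the period.
  have h3 := h1 (j + m * n)
  rwa [show j + m * n + m = j + m * (n + 1) by ring, ← (bridge_periodic x).map_mod_nat (j + _),
    Nat.add_mul_mod_self_right, (bridge_periodic x).map_mod_nat] at h3

/-- The cycle lemma: almost every closed bridge has exactly one nonnegative rotation. -/
theorem cycle_lemma {A : Set (Fin n → ℝ)} (hA : MeasurableSet A)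
    (hrot : ∀ x, rotate n x ∈ A ↔ x ∈ A) :
    (n + 1) * bridgeMeasure n (nonnegBridges n ∩ A) = bridgeMeasure n A := by
  set μ := bridgeMeasure n
  have hpow (m : ℕ) : MeasurePreserving (rotate n ^ m : Module.End ℝ (Fin n → ℝ)) μ μ := by
    rw [Module.End.coe_pow]
    exact measurePreserving_rotate.iterate m
  have hpowA (m : ℕ) (x : Fin n → ℝ) : (rotate n ^ m) x ∈ A ↔ x ∈ A := by
    induction m with
    | zero => simp
    | succ m ih => rw [pow_succ', Module.End.mul_apply, hrot, ih]
  let E (m : Fin (n + 1)) : Set (Fin n → ℝ) :=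
    (rotate n ^ (m : ℕ) : Module.End ℝ (Fin n → ℝ)) ⁻¹' (nonnegBridges n ∩ A)
  have hE (m : Fin (n + 1)) : MeasurableSet (E m) :=
    (hpow m).measurable (measurableSet_nonnegBridges.inter hA)
  have hEmem (m : Fin (n + 1)) (x : Fin n → ℝ) :
      x ∈ E m ↔ (∀ j, bridge x m ≤ bridge x j) ∧ x ∈ A := by
    simp only [E, Set.mem_preimage, Set.mem_inter_iff, rotate_pow_mem_nonnegBridges, hpowA]
  -- Two distinct nonnegative rotations would start at two times where the minimum is attained, a
  -- null event.
  have hdisj : Pairwise (Function.onFun (AEDisjoint μ) E) := by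
    have hlt (m l : Fin (n + 1)) (h : m < l) : AEDisjoint μ (E m) (E l) := by
      refine measure_mono_null ?_ (bridgeMeasure_bridge_eq (n := n) (m := m) (l := l) h
        (Nat.le_of_lt_succ l.2))
      rintro x ⟨h1, h2⟩
      exact le_antisymm (((hEmem m x).1 h1).1 _) (((hEmem l x).1 h2).1 _)
    intro m l hml
    rcases lt_or_gt_of_ne hml with h | h
    · exact hlt m l h
    · exact (hlt l m h).symm
  -- Existence: start the bridge at a time where it is minimal.
  have hU : ⋃ m, E m = A := by
    ext x
    simp only [Set.mem_iUnion, hEmem]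
    refine ⟨fun ⟨_, _, h⟩ => h, fun h => ?_⟩
    obtain ⟨m, hm⟩ := Finite.exists_min (fun m : Fin (n + 1) => bridge x m)
    refine ⟨m, fun j => ?_, h⟩
    rw [← (bridge_periodic x).map_mod_nat j]
    exact hm ⟨j % (n + 1), Nat.mod_lt _ (Nat.succ_pos n)⟩
  calc (n + 1) * μ (nonnegBridges n ∩ A) = ∑ m : Fin (n + 1), μ (E m) := by
        simp only [E, (hpow _).measure_preimage
          (measurableSet_nonnegBridges.inter hA).nullMeasurableSet]
        simp
    _ = μ (⋃ m, E m) := by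
        rw [measure_iUnion₀ hdisj fun m => (hE m).nullMeasurableSet, tsum_fintype]
    _ = μ A := by rw [hU]

/-! ### Spacings of bridges -/

/-- The `k`-th spacing of the values of a bridge over a period. -/
noncomputable def bridgeSpacing (k : ℕ) (x : Fin n → ℝ) : ℝ :=
  orderStat n (bridge x) k - orderStat n (bridge x) (k - 1)

@[fun_prop]
theorem measurable_bridgeSpacing (k : ℕ) : Measurable (bridgeSpacing k : (Fin n → ℝ) → ℝ) := by
  have h : Measurable fun x : Fin n → ℝ => bridge x := measurable_pi_lambda _ measurable_bridge
  exact ((measurable_orderStat n k).comp h).sub ((measurable_orderStat n (k - 1)).comp h)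

/-- Rotation permutes the values over a period and translates them by a constant, which cancels in
differences. -/
theorem bridgeSpacing_rotate {k : ℕ} (hk : k ≤ n) (x : Fin n → ℝ) :
    bridgeSpacing k (rotate n x) = bridgeSpacing k x := by
  have h : bridge (rotate n x) = fun i => bridge x (i + 1) - bridge x 1 :=
    funext fun i => by simpa using bridge_rotate_pow x 1 i
  have h2 (k : ℕ) (hk : k ≤ n) : orderStat n (bridge (rotate n x)) k =
      orderStat n (bridge x) k - bridge x 1 := by
    rw [h, orderStat_sub_const hk (fun i => bridge x (i + 1)),
      orderStat_shift hk _ (bridge_periodic x)]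
  rw [bridgeSpacing, h2 k hk, h2 (k - 1) (by omega), bridgeSpacing]
  ring

theorem bridgeSpacing_neg {k : ℕ} (hk : k < n) (x : Fin n → ℝ) :
    bridgeSpacing (k + 1) (-x) = bridgeSpacing (n - k) x := by
  have h : bridge (-x) = fun i => -bridge x i := funext fun i => bridge_neg x i
  rw [bridgeSpacing, h, Nat.add_sub_cancel, orderStat_neg (by omega), orderStat_neg (by omega),
    bridgeSpacing, show n - k - 1 = n - (k + 1) by omega]
  ring

/-- Both spacing events are rotation invariant, so the cycle lemma removes the nonnegativity
constraint from each; negation then carries one event to the other. -/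
theorem bridgeMeasure_spacing_reverse {s : Set (Fin n → ℝ)} (hs : MeasurableSet s) :
    bridgeMeasure n (nonnegBridges n ∩ {x | (fun i : Fin n => bridgeSpacing (i + 1) x) ∈ s}) =
      bridgeMeasure n (nonnegBridges n ∩ {x | (fun i : Fin n => bridgeSpacing (n - i) x) ∈ s}) := by
  have h1 : MeasurableSet {x : Fin n → ℝ | (fun i : Fin n => bridgeSpacing (i + 1) x) ∈ s} :=
    measurable_pi_lambda _ (fun i => measurable_bridgeSpacing _) hs
  have h2 : MeasurableSet {x : Fin n → ℝ | (fun i : Fin n => bridgeSpacing (n - i) x) ∈ s} :=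
    measurable_pi_lambda _ (fun i => measurable_bridgeSpacing _) hs
  have hn : ((n : ℝ≥0∞) + 1) ≠ 0 := by simp
  have hn' : ((n : ℝ≥0∞) + 1) ≠ ∞ := by simp
  rw [← ENNReal.mul_right_inj hn hn', cycle_lemma h1, cycle_lemma h2,
    ← measurePreserving_neg_bridgeMeasure.measure_preimage h1.nullMeasurableSet]
  · simp only [Set.preimage_ofPred_eq]
    congr 1
    ext x
    simp only [Set.mem_ofPred_eq]
    rw [show (fun i : Fin n => bridgeSpacing (i + 1) (-x)) = fun i : Fin n => bridgeSpacing (n - i) x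
      from funext fun i => bridgeSpacing_neg i.2 x]
  · intro x
    simp only [Set.mem_ofPred_eq]
    rw [show (fun i : Fin n => bridgeSpacing (n - i) (rotate n x)) =
      fun i : Fin n => bridgeSpacing (n - i) x
      from funext fun i => bridgeSpacing_rotate (by omega) x]
  · intro x
    simp only [Set.mem_ofPred_eq]
    rw [show (fun i : Fin n => bridgeSpacing (i + 1) (rotate n x)) =
      fun i : Fin n => bridgeSpacing (i + 1) x
      from funext fun i => bridgeSpacing_rotate (by omega) x]

/-- Otherwise the cycle lemma would make the whole bridge measure vanish, although its density is
nowhere zero. -/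
theorem bridgeMeasure_nonnegBridges_pos : 0 < bridgeMeasure n (nonnegBridges n) := by
  have h := cycle_lemma (n := n) MeasurableSet.univ (by simp)
  rw [Set.inter_univ] at h
  refine pos_iff_ne_zero.2 fun h0 => ?_
  rw [h0, mul_zero, eq_comm, bridgeMeasure, Measure.measure_univ_eq_zero,
    withDensity_eq_zero_iff measurable_bridgeDensity.aemeasurable] at h
  obtain ⟨x, hx⟩ := h.exists
  exact Finset.prod_ne_zero_iff.2 (fun i _ => laplaceDensity_ne_zero _) hx

end Bridge

/-! ### Integrals against the Laplace distribution -/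

instance : SFinite laplaceMeasure := inferInstanceAs (SFinite (volume.withDensity _))

theorem lintegral_laplaceMeasure {f : ℝ → ℝ≥0∞} (hf : Measurable f) :
    ∫⁻ y, f y ∂laplaceMeasure = ∫⁻ y, laplaceDensity y * f y := by
  change ∫⁻ y, f y ∂(volume.withDensity laplaceDensity) = _
  rw [lintegral_withDensity_eq_lintegral_mul _ measurable_laplaceDensity hf]
  rfl

/-- This coincidence of tail and density is the one place where the exponential shape is essential
to the reversal: it turns the exit step into the closing increment of a bridge. -/
theorem laplaceMeasure_Iio_neg {s : ℝ} (hs : 0 ≤ s) :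
    laplaceMeasure (Set.Iio (-s)) = laplaceDensity s := by
  change volume.withDensity laplaceDensity _ = _
  rw [withDensity_apply _ measurableSet_Iio,
    setLIntegral_congr_fun measurableSet_Iio (g := fun y => ENNReal.ofReal (1 / 2 * Real.exp y)),
    setLIntegral_congr Iio_ae_eq_Iic, ← ofReal_integral_eq_lintegral_ofReal, integral_const_mul,
    integral_exp_Iic, laplaceDensity, abs_of_nonneg hs]
  · exact (integrableOn_exp_Iic _).const_mul _
  · exact Filter.Eventually.of_forall fun y => by positivity
  · intro y hy
    have : y < 0 := lt_of_lt_of_le (Set.mem_Iio.1 hy) (by linarith)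
    simp [laplaceDensity, abs_of_neg this]

/-- The function `z ↦ z + 1` on the nonnegative half-line, extended by `0`. It is harmonic for the
Laplace walk killed on entering the negative half-line. -/
noncomputable def killedHarmonic : ℝ → ℝ≥0∞ :=
  (Set.Ici 0).indicator fun z => ENNReal.ofReal (z + 1)

@[fun_prop]
theorem measurable_killedHarmonic : Measurable killedHarmonic :=
  Measurable.indicator (by fun_prop) measurableSet_Ici

theorem setLIntegral_Ioc_killed {s : ℝ} (hs : 0 ≤ s) :
    ∫⁻ y in Set.Ioc (-s) 0, ENNReal.ofReal ((s + y + 1) * (1 / 2 * Real.exp y)) =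
      ENNReal.ofReal (s / 2) := by
  have hc : Continuous fun y : ℝ => (s + y + 1) * (1 / 2 * Real.exp y) := by fun_prop
  have hd (y : ℝ) : HasDerivAt (fun y => 1 / 2 * ((s + y) * Real.exp y))
      ((s + y + 1) * (1 / 2 * Real.exp y)) y := by
    have := (((hasDerivAt_id y).const_add s).mul (Real.hasDerivAt_exp y)).const_mul (1 / 2)
    refine this.congr_deriv ?_
    simp
    ring
  rw [← ofReal_integral_eq_lintegral_ofReal, ← intervalIntegral.integral_of_le (by linarith),
    intervalIntegral.integral_eq_sub_of_hasDerivAt (fun y _ => hd y) (hc.intervalIntegrable _ _)]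
  · congr 1
    simp
    ring
  · exact (hc.intervalIntegrable _ _).1
  · filter_upwards [ae_restrict_mem measurableSet_Ioc] with y hy
    have : 0 ≤ s + y + 1 := by linarith [hy.1]
    positivity

theorem setLIntegral_Ioi_killed {s : ℝ} (hs : 0 ≤ s) :
    ∫⁻ y in Set.Ioi 0, ENNReal.ofReal ((s + y + 1) * (1 / 2 * Real.exp (-y))) =
      ENNReal.ofReal (s / 2 + 1) := by
  have hd (y : ℝ) : HasDerivAt (fun y => -(1 / 2) * ((s + y + 2) * Real.exp (-y)))
      ((s + y + 1) * (1 / 2 * Real.exp (-y))) y := by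
    have := ((((hasDerivAt_id y).const_add s).add_const 2).mul
      (hasDerivAt_id y).neg.exp).const_mul (-(1 / 2))
    refine this.congr_deriv ?_
    simp
    ring
  have hpos : ∀ y ∈ Set.Ioi (0 : ℝ), 0 ≤ (s + y + 1) * (1 / 2 * Real.exp (-y)) := fun y hy => by
    have : 0 ≤ s + y + 1 := by linarith [Set.mem_Ioi.1 hy]
    positivity
  have hlim : Filter.Tendsto (fun y => -(1 / 2) * ((s + y + 2) * Real.exp (-y))) Filter.atTop
      (nhds 0) := by
    have h1 := Real.tendsto_pow_mul_exp_neg_atTop_nhds_zero 1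
    have h0 := Real.tendsto_pow_mul_exp_neg_atTop_nhds_zero 0
    have := ((h0.const_mul (s + 2)).add h1).const_mul (-(1 / 2))
    simp only [mul_zero, add_zero] at this
    refine this.congr fun y => ?_
    ring
  rw [← ofReal_integral_eq_lintegral_ofReal,
    integral_Ioi_of_hasDerivAt_of_nonneg' (fun y _ => hd y) hpos hlim]
  · congr 1
    simp
    ring
  · exact integrableOn_Ioi_deriv_of_nonneg' (fun y _ => hd y) hpos hlim
  · filter_upwards [ae_restrict_mem measurableSet_Ioi] with y hy using hpos y hy

/-- Downward steps that stay nonnegative contribute `s / 2` and upward steps `s / 2 + 1`; steps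
below `-s` are killed. -/
theorem lintegral_killedHarmonic {s : ℝ} (hs : 0 ≤ s) :
    ∫⁻ y, killedHarmonic (s + y) ∂laplaceMeasure = killedHarmonic s := by
  have hsplit : Set.Ioi (-s) = Set.Ioc (-s) 0 ∪ Set.Ioi 0 :=
    (Set.Ioc_union_Ioi_eq_Ioi (by linarith)).symm
  have hfun : (fun y => laplaceDensity y * killedHarmonic (s + y)) =
      (Set.Ici (-s)).indicator fun y =>
        ENNReal.ofReal ((s + y + 1) * (1 / 2 * Real.exp (-|y|))) := by
    funext y
    by_cases hy : -s ≤ y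
    · have h1 : s + y ∈ Set.Ici (0 : ℝ) := by simp only [Set.mem_Ici]; linarith
      rw [Set.indicator_of_mem (Set.mem_Ici.2 hy), killedHarmonic, Set.indicator_of_mem h1,
        laplaceDensity, ← ENNReal.ofReal_mul (by positivity), mul_comm]
    · have h1 : s + y ∉ Set.Ici (0 : ℝ) := by simp only [Set.mem_Ici]; linarith
      rw [Set.indicator_of_notMem (by simpa using hy), killedHarmonic,
        Set.indicator_of_notMem h1, mul_zero]
  rw [lintegral_laplaceMeasure (by fun_prop), hfun, lintegral_indicator measurableSet_Ici,
    setLIntegral_congr Ioi_ae_eq_Ici.symm, hsplit,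
    lintegral_union measurableSet_Ioi (Set.Ioc_disjoint_Ioi le_rfl),
    setLIntegral_congr_fun measurableSet_Ioc
      (g := fun y => ENNReal.ofReal ((s + y + 1) * (1 / 2 * Real.exp y))),
    setLIntegral_congr_fun measurableSet_Ioi
      (g := fun y => ENNReal.ofReal ((s + y + 1) * (1 / 2 * Real.exp (-y)))),
    setLIntegral_Ioc_killed hs, setLIntegral_Ioi_killed hs,
    ← ENNReal.ofReal_add (by positivity) (by positivity), killedHarmonic,
    Set.indicator_of_mem (Set.mem_Ici.2 hs)]
  · congr 1
    ring
  · intro y hy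
    simp only [abs_of_pos (Set.mem_Ioi.1 hy)]
  · intro y hy
    simp only [abs_of_nonpos hy.2, neg_neg]

/-! ### The history of the walk -/

section Walk

variable {Ω : Type*}

/-- The first `n` increments. -/
def history (X : ℕ → Ω → ℝ) (n : ℕ) (ω : Ω) (i : Fin n) : ℝ := X i ω

theorem bridge_history (X : ℕ → Ω → ℝ) {n k : ℕ} (hk : k ≤ n) (ω : Ω) :
    bridge (history X n ω) k = walk X k ω := by
  refine Finset.sum_congr rfl fun i hi => ?_
  rw [closing_of_lt _ ((Finset.mem_range.1 hi).trans_le hk)]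
  rfl

theorem history_mem_nonnegBridges (X : ℕ → Ω → ℝ) (n : ℕ) (ω : Ω) :
    history X n ω ∈ nonnegBridges n ↔ ∀ j ≤ n, 0 ≤ walk X j ω := by
  refine forall₂_congr fun j hj => ?_
  rw [bridge_history X hj]

theorem history_succ_mem_nonnegBridges (X : ℕ → Ω → ℝ) (n : ℕ) (ω : Ω) :
    history X (n + 1) ω ∈ nonnegBridges (n + 1) ↔
      history X n ω ∈ nonnegBridges n ∧ 0 ≤ bridge (history X n ω) n + X n ω := by
  rw [history_mem_nonnegBridges, history_mem_nonnegBridges, bridge_history X le_rfl]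
  have h : walk X (n + 1) ω = walk X n ω + X n ω := by simp [walk, Finset.sum_range_succ]
  rw [← h]
  refine ⟨fun H => ⟨fun j hj => H j (by omega), H _ le_rfl⟩, fun H j hj => ?_⟩
  rcases Nat.le_succ_iff.1 hj with h' | h'
  · exact H.1 j h'
  · exact h' ▸ H.2

theorem natCast_le_nu (X : ℕ → Ω → ℝ) (n : ℕ) (ω : Ω) :
    (n : ℕ∞) ≤ nu X ω ↔ history X n ω ∈ nonnegBridges n := by
  have h0 : (1 : ℕ∞) ≤ tauMinus X ω := by
    rw [Order.one_le_iff_pos, pos_iff_ne_zero]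
    intro h
    have h1 : hittingAfter (walk X) (Set.Iio 0) 0 ω ≤ ((0 : ℕ) : WithTop ℕ) := le_of_eq h
    obtain ⟨j, hj, hj'⟩ := hittingAfter_le_iff.1 h1
    obtain rfl : j = 0 := by simpa using hj
    simp [walk] at hj'
  have h1 : (n : ℕ∞) ≤ nu X ω ↔ ¬ tauMinus X ω ≤ (n : ℕ∞) := by
    rw [nu]
    generalize tauMinus X ω = t at *
    induction t with
    | top => simp
    | coe t =>
      norm_cast at *
      omega
  have h2 : tauMinus X ω ≤ (n : ℕ∞) ↔ ∃ j ∈ Set.Icc 0 n, walk X j ω ∈ Set.Iio 0 :=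
    hittingAfter_le_iff
  rw [h1, h2, history_mem_nonnegBridges]
  simp

theorem nu_eq_natCast (X : ℕ → Ω → ℝ) (n : ℕ) (ω : Ω) :
    nu X ω = n ↔ history X n ω ∈ nonnegBridges n ∧
      bridge (history X n ω) n + X n ω < 0 := by
  have h : nu X ω = n ↔ (n : ℕ∞) ≤ nu X ω ∧ ¬ ((n + 1 : ℕ) : ℕ∞) ≤ nu X ω := by
    generalize nu X ω = t
    induction t with
    | top => simp
    | coe t =>
      norm_cast
      omega
  rw [h, natCast_le_nu, natCast_le_nu, history_succ_mem_nonnegBridges, not_and, not_le]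
  tauto

theorem spacing_eq_bridgeSpacing {X : ℕ → Ω → ℝ} {n : ℕ} {ω : Ω} (h : nu X ω = n) (k : ℕ) :
    spacing X k ω = bridgeSpacing k (history X n ω) := by
  have hc (k : ℕ) : orderStat n (fun i => walk X i ω) k =
      orderStat n (bridge (history X n ω)) k :=
    orderStat_congr (fun i hi => (bridge_history X hi ω).symm) k
  simp only [spacing, M, h, ENat.toNat_natCast, hc, bridgeSpacing]

variable [MeasurableSpace Ω] {P : Measure Ω} [IsProbabilityMeasure P] {X : ℕ → Ω → ℝ}

theorem measurable_history (hmeas : ∀ i, Measurable (X i)) (n : ℕ) : Measurable (history X n) :=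
  measurable_pi_lambda _ fun i => hmeas i

theorem measurableSet_nu_eq (hmeas : ∀ i, Measurable (X i)) (n : ℕ) :
    MeasurableSet {ω | nu X ω = n} := by
  simp only [nu_eq_natCast]
  exact (measurable_history hmeas n measurableSet_nonnegBridges).inter
    (measurableSet_lt (((measurable_bridge n).comp (measurable_history hmeas n)).add (hmeas n))
      measurable_const)

theorem lintegral_history_next (hmeas : ∀ i, Measurable (X i))
    (hlaw : ∀ i, P.map (X i) = laplaceMeasure) (hindep : iIndepFun X P) (n : ℕ)
    {f : (Fin n → ℝ) × ℝ → ℝ≥0∞} (hf : Measurable f) :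
    ∫⁻ ω, f (history X n ω, X n ω) ∂P =
      ∫⁻ ω, ∫⁻ y, f (history X n ω, y) ∂laplaceMeasure ∂P := by
  have hi : IndepFun (history X n) (X n) P := by
    have hn : Measurable fun v : ({n} : Finset ℕ) → ℝ => v ⟨n, Finset.mem_singleton_self n⟩ :=
      measurable_pi_apply _
    have h := hindep.indepFun_finset (Finset.range n) {n} (by simp) hmeas
    exact h.comp (φ := fun v (i : Fin n) => v ⟨i, Finset.mem_range.2 i.2⟩)
      (ψ := fun v => v ⟨n, Finset.mem_singleton_self n⟩) (by fun_prop) hn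
  have hm := measurable_history hmeas n
  rw [indepFun_iff_map_prod_eq_prod_map_map hm.aemeasurable (hmeas n).aemeasurable, hlaw] at hi
  rw [← lintegral_map (f := f) (g := fun ω => (history X n ω, X n ω)) hf (hm.prodMk (hmeas n)), hi,
    lintegral_prod _ hf.aemeasurable, lintegral_map hf.lintegral_prod_right' hm]

theorem lintegral_history (hmeas : ∀ i, Measurable (X i))
    (hlaw : ∀ i, P.map (X i) = laplaceMeasure) (hindep : iIndepFun X P) (n : ℕ)
    {g : (Fin n → ℝ) → ℝ≥0∞} (hg : Measurable g) :
    ∫⁻ ω, g (history X n ω) ∂P = ∫⁻ x, g x * ∏ i, laplaceDensity (x i) := by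
  induction n with
  | zero =>
    rw [show (volume : Measure (Fin 0 → ℝ)) = Measure.dirac default from
      Measure.pi_of_empty _ _, lintegral_dirac]
    rw [lintegral_congr fun ω => congrArg g (Subsingleton.elim (history X 0 ω) default)]
    simp
  | succ n ih =>
    have hsnoc : Measurable fun z : (Fin n → ℝ) × ℝ => (Fin.snoc z.1 z.2 : Fin (n + 1) → ℝ) := by
      refine measurable_pi_lambda _ fun i => ?_
      induction i using Fin.lastCases with
      | last => simpa using measurable_snd
      | cast i => simpa [Function.comp_def] using (measurable_pi_apply i).comp measurable_fst
    have h1 (ω : Ω) : history X (n + 1) ω = Fin.snoc (history X n ω) (X n ω) := by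
      funext i
      induction i using Fin.lastCases <;> simp [history]
    have hg' := hg.comp hsnoc
    simp only [h1]
    refine (lintegral_history_next hmeas hlaw hindep n hg').trans
      ((ih hg'.lintegral_prod_right').trans ?_)
    have he := (volume_preserving_piFinSuccAbove (fun _ : Fin (n + 1) => ℝ) (Fin.last n)).symm
    rw [← he.lintegral_comp_emb (MeasurableEquiv.measurableEmbedding _), Measure.volume_eq_prod, lintegral_prod_symm]
    · refine lintegral_congr fun x => ?_
      have hgx : Measurable fun y => (g ∘ fun z : (Fin n → ℝ) × ℝ =>
        (Fin.snoc z.1 z.2 : Fin (n + 1) → ℝ)) (x, y) := hg'.comp measurable_prodMk_left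
      rw [lintegral_laplaceMeasure hgx, ← lintegral_mul_const]
      · refine lintegral_congr fun y => ?_
        simp [Fin.prod_univ_castSucc, MeasurableEquiv.piFinSuccAbove, Fin.insertNthEquiv]
        ring
      · exact measurable_laplaceDensity.mul hgx
    · have hm : Measurable fun x : Fin (n + 1) → ℝ => g x * ∏ i, laplaceDensity (x i) := by
        fun_prop
      exact (hm.comp he.measurable).aemeasurable

/-- Given the history, only the next step is random, and it must fall below `-bridge x n`; integrate
it out. -/
theorem measure_nu_eq_inter (hmeas : ∀ i, Measurable (X i))
    (hlaw : ∀ i, P.map (X i) = laplaceMeasure) (hindep : iIndepFun X P) (n : ℕ)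
    {A : Set (Fin n → ℝ)} (hA : MeasurableSet A) :
    P ({ω | nu X ω = n} ∩ {ω | history X n ω ∈ A}) =
      ∫⁻ ω, (nonnegBridges n ∩ A).indicator (fun x => laplaceDensity (bridge x n))
        (history X n ω) ∂P := by
  have hB := measurableSet_nonnegBridges.inter hA
  let C : Set ((Fin n → ℝ) × ℝ) := {z | z.1 ∈ nonnegBridges n ∩ A ∧ bridge z.1 n + z.2 < 0}
  have hC : MeasurableSet C := (measurable_fst hB).inter
    (measurableSet_lt (((measurable_bridge n).comp measurable_fst).add measurable_snd)
      measurable_const)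
  have h1 : {ω | nu X ω = n} ∩ {ω | history X n ω ∈ A} =
      (fun ω => (history X n ω, X n ω)) ⁻¹' C := by
    ext ω
    simp only [C, nu_eq_natCast, Set.mem_inter_iff, Set.mem_ofPred_eq, Set.mem_preimage]
    tauto
  have hpre := ((measurable_history hmeas n).prodMk (hmeas n)) hC
  rw [h1, ← lintegral_indicator_one hpre]
  refine (lintegral_history_next hmeas hlaw hindep n
    (measurable_one.indicator hC)).trans (lintegral_congr fun ω => ?_)
  by_cases hω : history X n ω ∈ nonnegBridges n ∩ A
  · rw [Set.indicator_of_mem hω, ← laplaceMeasure_Iio_neg (hω.1 n le_rfl),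
      ← lintegral_indicator_one measurableSet_Iio]
    refine lintegral_congr fun y => ?_
    have : (history X n ω, y) ∈ C ↔ y ∈ Set.Iio (-bridge (history X n ω) n) := by
      simp only [C, Set.mem_ofPred_eq, hω, true_and, Set.mem_Iio]
      constructor <;> intro h <;> linarith
    by_cases hy : y ∈ Set.Iio (-bridge (history X n ω) n)
    · rw [Set.indicator_of_mem hy, Set.indicator_of_mem (this.2 hy)]
      rfl
    · rw [Set.indicator_of_notMem hy, Set.indicator_of_notMem (mt this.1 hy)]
  · rw [Set.indicator_of_notMem hω, ← lintegral_zero (μ := laplaceMeasure)]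
    exact lintegral_congr fun y => Set.indicator_of_notMem (fun h => hω h.1) _

/-- On `{ν = n}` the first `n` increments are distributed as those of a nonnegative bridge. -/
theorem measure_nu_eq_inter_eq_bridgeMeasure (hmeas : ∀ i, Measurable (X i))
    (hlaw : ∀ i, P.map (X i) = laplaceMeasure) (hindep : iIndepFun X P) (n : ℕ)
    {A : Set (Fin n → ℝ)} (hA : MeasurableSet A) :
    P ({ω | nu X ω = n} ∩ {ω | history X n ω ∈ A}) =
      bridgeMeasure n (nonnegBridges n ∩ A) := by
  have hB := measurableSet_nonnegBridges.inter hA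
  have hm : Measurable ((nonnegBridges n ∩ A).indicator fun x => laplaceDensity (bridge x n)) :=
    Measurable.indicator (by fun_prop) hB
  rw [measure_nu_eq_inter hmeas hlaw hindep n hA, lintegral_history hmeas hlaw hindep n hm,
    bridgeMeasure, withDensity_apply _ hB, ← lintegral_indicator hB]
  refine lintegral_congr fun x => ?_
  by_cases hx : x ∈ nonnegBridges n ∩ A
  · rw [Set.indicator_of_mem hx, Set.indicator_of_mem hx, bridgeDensity_eq, mul_comm]
  · rw [Set.indicator_of_notMem hx, Set.indicator_of_notMem hx, zero_mul]

/-! ### Finiteness of `ν` -/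

/-- Harmonicity keeps the expectation constant in `n`, starting from the value `1` at height `0`. -/
theorem lintegral_killedHarmonic_le_one (hmeas : ∀ i, Measurable (X i))
    (hlaw : ∀ i, P.map (X i) = laplaceMeasure) (hindep : iIndepFun X P) (n : ℕ) :
    ∫⁻ ω, (nonnegBridges n).indicator (fun x => killedHarmonic (bridge x n))
      (history X n ω) ∂P ≤ 1 := by
  induction n with
  | zero =>
    refine (lintegral_mono (g := fun _ => 1) fun ω => ?_).trans (by simp)
    refine (Set.indicator_le_self _ _ _).trans ?_
    simp [bridge_zero, killedHarmonic]
  | succ n ih =>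
    refine le_trans (le_of_eq ?_) ih
    have hm : Measurable fun z : (Fin n → ℝ) × ℝ =>
        (nonnegBridges n).indicator (fun _ => (1 : ℝ≥0∞)) z.1 *
          killedHarmonic (bridge z.1 n + z.2) := by
      refine Measurable.mul ?_ ?_
      · exact (measurable_const.indicator measurableSet_nonnegBridges).comp measurable_fst
      · exact measurable_killedHarmonic.comp
          (((measurable_bridge n).comp measurable_fst).add measurable_snd)
    trans ∫⁻ ω, (nonnegBridges n).indicator (fun _ => (1 : ℝ≥0∞)) (history X n ω) *
      killedHarmonic (bridge (history X n ω) n + X n ω) ∂P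
    · refine lintegral_congr fun ω => ?_
      have hb : bridge (history X (n + 1) ω) (n + 1) = bridge (history X n ω) n + X n ω := by
        rw [bridge_history X le_rfl, bridge_history X le_rfl]
        simp [walk, Finset.sum_range_succ]
      by_cases h1 : history X n ω ∈ nonnegBridges n
      · by_cases h2 : 0 ≤ bridge (history X n ω) n + X n ω
        · rw [Set.indicator_of_mem ((history_succ_mem_nonnegBridges X n ω).2 ⟨h1, h2⟩),
            Set.indicator_of_mem h1, one_mul, hb]
        · rw [Set.indicator_of_notMem fun h => h2 ((history_succ_mem_nonnegBridges X n ω).1 h).2,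
            killedHarmonic, Set.indicator_of_notMem (s := Set.Ici (0 : ℝ)) h2, mul_zero]
      · rw [Set.indicator_of_notMem fun h => h1 ((history_succ_mem_nonnegBridges X n ω).1 h).1,
          Set.indicator_of_notMem h1, zero_mul]
    · refine (lintegral_history_next hmeas hlaw hindep n hm).trans (lintegral_congr fun ω => ?_)
      simp only
      by_cases h1 : history X n ω ∈ nonnegBridges n
      · simp only [Set.indicator_of_mem h1, one_mul]
        exact lintegral_killedHarmonic (h1 n le_rfl)
      · simp only [Set.indicator_of_notMem h1, zero_mul, lintegral_zero]

/-- A walk surviving to time `n` is either above `K`, which the bound on the harmonic function makes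
unlikely by Markov's inequality, or at most `K`, where it exits at the next step with probability at
least `laplaceDensity K`. -/
theorem measure_nu_eq_top_le (hmeas : ∀ i, Measurable (X i))
    (hlaw : ∀ i, P.map (X i) = laplaceMeasure) (hindep : iIndepFun X P) (n K : ℕ) :
    P {ω | nu X ω = ⊤} ≤
      ((K : ℝ≥0∞) + 1)⁻¹ + (laplaceDensity K)⁻¹ * P {ω | nu X ω = n} := by
  have hH := measurable_history hmeas n
  have hS : Measurable fun ω => bridge (history X n ω) n := (measurable_bridge n).comp hH
  have hN : MeasurableSet {ω | history X n ω ∈ nonnegBridges n} := hH measurableSet_nonnegBridges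
  have hsub : {ω | nu X ω = ⊤} ⊆
      ({ω | history X n ω ∈ nonnegBridges n} ∩ {ω | (K : ℝ) < bridge (history X n ω) n}) ∪
      ({ω | history X n ω ∈ nonnegBridges n} ∩ {ω | bridge (history X n ω) n ≤ K}) := by
    intro ω hω
    have h1 : history X n ω ∈ nonnegBridges n := by
      rw [← natCast_le_nu, show nu X ω = ⊤ from hω]
      exact le_top
    rcases lt_or_ge (K : ℝ) (bridge (history X n ω) n) with h | h
    · exact Or.inl ⟨h1, h⟩
    · exact Or.inr ⟨h1, h⟩
  refine (measure_mono hsub).trans ((measure_union_le _ _).trans (add_le_add ?_ ?_))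
  · rw [ENNReal.le_inv_iff_mul_le, mul_comm,
      ← setLIntegral_const]
    refine le_trans ?_ (lintegral_killedHarmonic_le_one hmeas hlaw hindep n)
    rw [← lintegral_indicator (hN.inter (measurableSet_lt measurable_const hS))]
    refine lintegral_mono (Set.indicator_le fun ω hω => ?_)
    have h0 : (0 : ℝ) ≤ bridge (history X n ω) n := hω.1 n le_rfl
    rw [Set.indicator_of_mem (s := nonnegBridges n) hω.1, killedHarmonic, Set.indicator_of_mem (Set.mem_Ici.2 h0),
      ENNReal.ofReal_add h0 zero_le_one, ENNReal.ofReal_one, ← ENNReal.ofReal_natCast]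
    exact add_le_add_left (ENNReal.ofReal_le_ofReal hω.2.le) 1
  · rw [mul_comm, ← div_eq_mul_inv, ENNReal.le_div_iff_mul_le
      (Or.inl (laplaceDensity_ne_zero _)) (Or.inl ENNReal.ofReal_ne_top), mul_comm,
      ← setLIntegral_const]
    have h := measure_nu_eq_inter hmeas hlaw hindep n MeasurableSet.univ
    simp only [Set.mem_univ, Set.ofPred_true, Set.inter_univ] at h
    rw [h, ← lintegral_indicator (hN.inter (measurableSet_le hS measurable_const))]
    refine lintegral_mono (Set.indicator_le fun ω hω => ?_)
    have h0 : (0 : ℝ) ≤ bridge (history X n ω) n := hω.1 n le_rfl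
    have h2 : bridge (history X n ω) n ≤ K := hω.2
    rw [Set.indicator_of_mem (s := nonnegBridges n) hω.1, laplaceDensity, laplaceDensity, abs_of_nonneg h0,
      abs_of_nonneg (Nat.cast_nonneg K)]
    gcongr

/-- The events `{ν = n}` are disjoint, so their probabilities tend to `0`. Let `n → ∞` for fixed
`K`, then `K → ∞`. -/
theorem measure_nu_eq_top (hmeas : ∀ i, Measurable (X i))
    (hlaw : ∀ i, P.map (X i) = laplaceMeasure) (hindep : iIndepFun X P) :
    P {ω | nu X ω = ⊤} = 0 := by
  have hsum : ∑' n : ℕ, P {ω | nu X ω = n} ≠ ∞ := by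
    rw [← measure_iUnion _ fun n => measurableSet_nu_eq hmeas n]
    · exact measure_ne_top _ _
    · intro m n hmn
      refine Set.disjoint_left.2 fun ω h1 h2 => hmn ?_
      exact Nat.cast_injective (R := ℕ∞) ((Eq.symm h1).trans h2)
  have h0 := ENNReal.tendsto_atTop_zero_of_tsum_ne_top hsum
  have h1 (K : ℕ) : P {ω | nu X ω = ⊤} ≤ ((K : ℝ≥0∞) + 1)⁻¹ := by
    have h2 := (ENNReal.Tendsto.const_mul h0
      (Or.inr (ENNReal.inv_ne_top.2 (laplaceDensity_ne_zero K)))).const_add ((K : ℝ≥0∞) + 1)⁻¹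
    rw [mul_zero, add_zero] at h2
    exact ge_of_tendsto' h2 fun n => measure_nu_eq_top_le hmeas hlaw hindep n K
  have h3 : Filter.Tendsto (fun K : ℕ => ((K : ℝ≥0∞) + 1)⁻¹) Filter.atTop (nhds 0) := by
    have := (Filter.tendsto_add_atTop_iff_nat 1).2 ENNReal.tendsto_inv_nat_nhds_zero
    simpa using this
  exact le_antisymm (ge_of_tendsto' h3 h1) bot_le

/-! ### Reversal of the spacings -/

theorem measurable_toNat_nu (hmeas : ∀ i, Measurable (X i)) :
    Measurable fun ω => (nu X ω).toNat := by
  refine measurable_to_countable' fun k => ?_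
  -- As `⊤.toNat = 0`, the fibre over `0` also contains `{ν = ⊤}`.
  have h : (fun ω => (nu X ω).toNat) ⁻¹' {k} =
      {ω | nu X ω = k} ∪ ({ω | k = 0} ∩ (⋃ j : ℕ, {ω | nu X ω = j})ᶜ) := by
    ext ω
    simp only [Set.mem_preimage, Set.mem_singleton_iff, Set.mem_union, Set.mem_ofPred_eq,
      Set.mem_inter_iff, Set.mem_compl_iff, Set.mem_iUnion]
    generalize nu X ω = t
    induction t with
    | top => simp [eq_comm]
    | coe t => simp
  rw [h]
  exact (measurableSet_nu_eq hmeas k).union ((MeasurableSet.const _).inter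
    (MeasurableSet.iUnion fun j => measurableSet_nu_eq hmeas j).compl)

/-- The index is allowed to be random because the last spacings are counted down from `ν`. -/
theorem measurable_spacing_of_nat (hmeas : ∀ i, Measurable (X i)) {k : Ω → ℕ}
    (hk : Measurable k) : Measurable fun ω => spacing X (k ω) ω := by
  have hw : Measurable fun ω (i : ℕ) => walk X i ω :=
    measurable_pi_lambda _ fun i => Finset.measurable_fun_sum _ fun j _ => hmeas j
  have hos : Measurable fun z : (ℕ → ℝ) × (ℕ × ℕ) => orderStat z.2.1 z.1 z.2.2 :=
    measurable_from_prod_countable_left fun z => measurable_orderStat z.1 z.2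
  have hM (l : Ω → ℕ) (hl : Measurable l) : Measurable fun ω => M X (l ω) ω :=
    hos.comp (hw.prodMk ((measurable_toNat_nu hmeas).prodMk hl))
  exact (hM k hk).sub (hM _ ((measurable_of_countable fun j : ℕ => j - 1).comp hk))

theorem measurable_last_spacings (hmeas : ∀ i, Measurable (X i)) (m : ℕ) :
    Measurable fun ω (i : Fin m) => spacing X ((nu X ω).toNat - i) ω :=
  measurable_pi_lambda _ fun i : Fin m => measurable_spacing_of_nat hmeas
    (k := fun ω => (nu X ω).toNat - i)
    ((measurable_of_countable fun j : ℕ => j - i).comp (measurable_toNat_nu hmeas))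

theorem measure_nu_eq_spacing_reverse (hmeas : ∀ i, Measurable (X i))
    (hlaw : ∀ i, P.map (X i) = laplaceMeasure) (hindep : iIndepFun X P) (n : ℕ)
    {s : Set (Fin n → ℝ)} (hs : MeasurableSet s) :
    P ({ω | nu X ω = n} ∩ (fun ω (i : Fin n) => spacing X (i + 1) ω) ⁻¹' s) =
      P ({ω | nu X ω = n} ∩ (fun ω (i : Fin n) => spacing X (n - i) ω) ⁻¹' s) := by
  have key (k : Fin n → ℕ) :
      P ({ω | nu X ω = n} ∩ (fun ω (i : Fin n) => spacing X (k i) ω) ⁻¹' s) =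
        bridgeMeasure n (nonnegBridges n ∩ {x | (fun i => bridgeSpacing (k i) x) ∈ s}) := by
    rw [← measure_nu_eq_inter_eq_bridgeMeasure hmeas hlaw hindep n]
    · congr 1
      ext ω
      simp only [Set.mem_inter_iff, Set.mem_ofPred_eq, Set.mem_preimage]
      refine and_congr_right fun h => ?_
      simp only [spacing_eq_bridgeSpacing h]
    · exact measurable_pi_lambda _ (fun i => measurable_bridgeSpacing _) hs
  rw [key fun i => i + 1, key fun i => n - i, bridgeMeasure_spacing_reverse hs]

theorem measure_le_nu_spacing_reverse (hmeas : ∀ i, Measurable (X i))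
    (hlaw : ∀ i, P.map (X i) = laplaceMeasure) (hindep : iIndepFun X P) {m n : ℕ} (hmn : m ≤ n)
    {s : Set (Fin m → ℝ)} (hs : MeasurableSet s) :
    P ({ω | n ≤ nu X ω} ∩ (fun ω (i : Fin m) => spacing X (i + 1) ω) ⁻¹' s) =
      P ({ω | n ≤ nu X ω} ∩
        (fun ω (i : Fin m) => spacing X ((nu X ω).toNat - i) ω) ⁻¹' s) := by
  -- Split according to the value `n + j` of `ν`; the remaining event `{ν = ⊤}` is null.
  have key (A : Set Ω) (hA : MeasurableSet A) :
      P ({ω | n ≤ nu X ω} ∩ A) = ∑' j : ℕ, P ({ω | nu X ω = (n + j : ℕ)} ∩ A) := by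
    rw [← measure_iUnion]
    · refine le_antisymm ?_ (measure_mono ?_)
      · refine (measure_mono (t := (⋃ j : ℕ, {ω | nu X ω = (n + j : ℕ)} ∩ A) ∪
          {ω | nu X ω = ⊤}) ?_).trans ((measure_union_le _ _).trans ?_)
        · rintro ω ⟨h, hA⟩
          by_cases ht : nu X ω = ⊤
          · exact Or.inr ht
          · obtain ⟨N, hN⟩ := ENat.ne_top_iff_exists.1 ht
            have h' : n ≤ N := by
              rw [Set.mem_ofPred_eq, ← hN] at h
              exact_mod_cast h
            refine Or.inl (Set.mem_iUnion.2 ⟨N - n, ?_, hA⟩)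
            rw [Set.mem_ofPred_eq, ← hN, Nat.add_sub_cancel' h']
        · rw [measure_nu_eq_top hmeas hlaw hindep, add_zero]
      · refine Set.iUnion_subset fun j => Set.inter_subset_inter_left _ fun ω hω => ?_
        rw [Set.mem_ofPred_eq] at *
        rw [hω]
        exact_mod_cast Nat.le_add_right n j
    · intro i j hij
      refine Set.disjoint_left.2 fun ω h1 h2 => hij ?_
      have := Nat.cast_injective (R := ℕ∞) ((Eq.symm h1.1).trans h2.1)
      omega
    · exact fun j => (measurableSet_nu_eq hmeas _).inter hA
  rw [key _ (measurable_pi_lambda _ (fun i => measurable_spacing_of_nat hmeas measurable_const) hs),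
    key _ (measurable_last_spacings hmeas m hs)]
  refine tsum_congr fun j => ?_
  have hle : m ≤ n + j := by omega
  -- Reversing all `n + j` spacings and keeping the first `m` coordinates yields the last `m`
  -- spacings, read backwards.
  have hr := measure_nu_eq_spacing_reverse hmeas hlaw hindep (n + j)
    (s := (fun v (i : Fin m) => v (Fin.castLE hle i)) ⁻¹' s)
    (measurable_pi_lambda _ (fun i => measurable_pi_apply _) hs)
  refine hr.trans ?_
  congr 1
  ext ω
  simp only [Set.mem_inter_iff, Set.mem_ofPred_eq, Set.mem_preimage]
  refine and_congr_right fun h => ?_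
  simp only [h, ENat.toNat_natCast, Fin.val_castLE]

end Walk

end LaplaceWalk

theorem mainTheorem8 {Ω : Type*} [MeasurableSpace Ω] (P : Measure Ω) [IsProbabilityMeasure P]
    (X : ℕ → Ω → ℝ) (hmeas : ∀ i, Measurable (X i))
    (hlaw : ∀ i, P.map (X i) = LaplaceWalk.laplaceMeasure) (hindep : iIndepFun X P) :
    (∀ᵐ ω ∂P, LaplaceWalk.nu X ω ≠ ⊤) ∧
    ∀ n : ℕ, 1 ≤ n →
      0 < P {ω | LaplaceWalk.nu X ω = n} ∧
      IdentDistrib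
        (fun ω (i : Fin n) => LaplaceWalk.spacing X (i + 1) ω)
        (fun ω (i : Fin n) => LaplaceWalk.spacing X (n - i) ω)
        (ProbabilityTheory.cond P {ω | LaplaceWalk.nu X ω = n})
        (ProbabilityTheory.cond P {ω | LaplaceWalk.nu X ω = n}) ∧
      ∀ m : ℕ, 1 ≤ m → m ≤ n →
        IdentDistrib
          (fun ω (i : Fin m) => LaplaceWalk.spacing X (i + 1) ω)
          (fun ω (i : Fin m) => LaplaceWalk.spacing X ((LaplaceWalk.nu X ω).toNat - i) ω)
          (ProbabilityTheory.cond P {ω | n ≤ LaplaceWalk.nu X ω})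
          (ProbabilityTheory.cond P {ω | n ≤ LaplaceWalk.nu X ω}) := by
  have hconst {m : ℕ} (k : Fin m → ℕ) :
      Measurable fun ω (i : Fin m) => LaplaceWalk.spacing X (k i) ω :=
    measurable_pi_lambda _ fun i => LaplaceWalk.measurable_spacing_of_nat hmeas measurable_const
  refine ⟨?_, fun n _ => ⟨?_, ⟨?_, ?_, ?_⟩, fun m _ hmn => ⟨?_, ?_, ?_⟩⟩⟩
  · rw [ae_iff]
    simpa using LaplaceWalk.measure_nu_eq_top hmeas hlaw hindep
  · have h := LaplaceWalk.measure_nu_eq_inter_eq_bridgeMeasure hmeas hlaw hindep n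
      MeasurableSet.univ
    simp only [Set.mem_univ, Set.ofPred_true, Set.inter_univ] at h
    rw [h]
    exact LaplaceWalk.bridgeMeasure_nonnegBridges_pos
  · exact (hconst fun i => i + 1).aemeasurable
  · exact (hconst fun i => n - i).aemeasurable
  · refine Measure.ext fun s hs => ?_
    have hA := LaplaceWalk.measurableSet_nu_eq hmeas n
    rw [Measure.map_apply (hconst fun i => i + 1) hs, Measure.map_apply (hconst fun i => n - i) hs,
      cond_apply hA, cond_apply hA,
      LaplaceWalk.measure_nu_eq_spacing_reverse hmeas hlaw hindep n hs]
  · exact (hconst fun i => i + 1).aemeasurable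
  · exact (LaplaceWalk.measurable_last_spacings hmeas m).aemeasurable
  · refine Measure.ext fun s hs => ?_
    have hA : MeasurableSet {ω | n ≤ LaplaceWalk.nu X ω} := by
      simp only [LaplaceWalk.natCast_le_nu]
      exact LaplaceWalk.measurable_history hmeas n LaplaceWalk.measurableSet_nonnegBridges
    rw [Measure.map_apply (hconst fun i => i + 1) hs, Measure.map_apply (LaplaceWalk.measurable_last_spacings hmeas m) hs,
      cond_apply hA, cond_apply hA,
      LaplaceWalk.measure_le_nu_spacing_reverse hmeas hlaw hindep hmn hs]
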